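/- Let $A$ be a finite alphabet, and let $\sigma:A\to A^+$ be a substitution ($A^+$ is the set of nonempty words over $A$), extended by concatenation to words and to $A^{\mathbb Z}$, where $\sigma(x)=\cdots\sigma(x_{-1}).\sigma(x_0)\sigma(x_1)\cdots$ with $\sigma(x_0)$ starting at coordinate $0$. Suppose that $\sigma$ is of $n\ge 2$ primitive components, i.e. there are sets $\emptyset=A_0\subsetneq A_1\subsetneq\dots\subsetneq A_n=A$ such that $\sigma(c)\in A_i^+$ for all $1\le i\le n$ and $c\in A_i$, and such that for some $k\ge 1$, for all $1\le i\le n$, $c\in A_i\setminus A_{i-1}$ and $d\in A_i$, the letter $d$ occurs in $\sigma^k(c)$. Let $\sigma_2:A_2\to A_2^+$ be the restriction of $\sigma$, let $\mathcal L(\sigma_2)$ be the set of factors of the words $\sigma^m(c)$, $m\ge1$, $c\in A_2$, and let $$X_{\sigma_2}=\{x\in A^{\mathbb Z}: x_{-i}x_{-i+1}\cdots x_i\in\mathcal L(\sigma_2)\text{ for every } i\ge 1\},$$ with the left shift $T$. Suppose that $A_1=\{a\}$, that $\sigma(a)=a$, and that there is $p_1$ such that $a^p\notin\mathcal L(\sigma_2)$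 for all $p\ge p_1$. Then: 1. There is $\omega\in X_{\sigma_2}$ with $\sigma^q(\omega)=\omega$ for some $q\ge1$ and $X_{\sigma_2}=\overline{\{T^m\omega:m\in\mathbb Z\}}$. Moreover, whenever $k\ge1$, $b\in A_2\setminus A_1$ and $\sigma^k(b)=bv$ for a word $v$, such an $\omega$ can be chosen with $\omega_0\omega_1\omega_2\cdots=b\,v\,\sigma^k(v)\,\sigma^{2k}(v)\,\sigma^{3k}(v)\cdots$. 2. $X_{\sigma_2}$ is minimal: it is nonempty, and it is the closure of the $T$-orbit of each of its points. 3. $X_{\sigma_2}$ is uniquely ergodic: it carries exactly one $T$-invariant Borel probability measure. The Chacon substitution $a\mapsto a$, $b\mapsto bbab$ on $\{a,b\}$ satisfies these hypotheses with $n=2$, $A_1=\{a\}$, $A_2=\{a,b\}$; moreover $ab\in\mathcal L(\sigma)$ and $\sigma(ab)=ab\,v$ with $v=bab$. -/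

import Mathlib

/-- A substitution on the alphabet `A`: every letter is mapped to a nonempty word over `A`. -/
structure Substitution (A : Type*) where
  /-- The word `σ(a)`. -/
  toWord : A → List A
  toWord_ne_nil : ∀ a, toWord a ≠ []

namespace Substitution

variable {A : Type*}

/-- The extension of `σ` to finite words by concatenation. -/
def mapWord (σ : Substitution A) (w : List A) : List A := w.flatMap σ.toWord

/-- The `n`-word `σⁿ(a)`. -/
def powWord (σ : Substitution A) (n : ℕ) (a : A) : List A := σ.mapWord^[n] [a]

theorem length_le_mapWord (σ : Substitution A) (w : List A) :
    w.length ≤ (σ.mapWord w).length := by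
  induction w with
  | nil => simp
  | cons c w ih =>
    have h : 0 < (σ.toWord c).length := List.length_pos_iff.mpr (σ.toWord_ne_nil c)
    simp only [mapWord, List.flatMap_cons, List.length_append, List.length_cons] at ih ⊢
    omega

end Substitution

/-- The word `x_{[m, m+k)} = x_m x_{m+1} ⋯ x_{m+k-1}` read in a bi-infinite sequence. -/
def window {A : Type*} (x : ℤ → A) (m : ℤ) (k : ℕ) : List A :=
  List.ofFn fun j : Fin k => x (m + (j : ℤ))

namespace Substitution

variable {A : Type*}

/-- The extension of `σ` to bi-infinite sequences,
`σ(x) = ⋯ σ(x_{-2}) σ(x_{-1}) . σ(x_0) σ(x_1) ⋯`, where `σ(x_0)` starts at coordinate `0`.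
For `m ≥ 0`, coordinate `m` is the letter with (zero-based) index `m` of `σ(x_0) ⋯ σ(x_m)`;
coordinate `-(k+1)` is the letter with index `k`, counted from the right end,
of `σ(x_{-(k+1)}) ⋯ σ(x_{-1})`. -/
def mapSeq (σ : Substitution A) (x : ℤ → A) : ℤ → A
  | Int.ofNat m => (σ.mapWord (window x 0 (m + 1))).get
      ⟨m, lt_of_lt_of_le (by simp [window]) (σ.length_le_mapWord _)⟩
  | Int.negSucc k => (σ.mapWord (window x (-((k : ℤ) + 1)) (k + 1))).reverse.get
      ⟨k, by
        rw [List.length_reverse]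
        exact lt_of_lt_of_le (by simp [window]) (σ.length_le_mapWord _)⟩

/-- The prefix `b v τ(v) τ²(v) ⋯ τ^{m-1}(v)`, where `τ = σᵏ`, of the right-infinite sequence
`b v τ(v) τ²(v) τ³(v) ⋯`, which is fixed by `τ` if `τ(b) = b v`. -/
def rightPrefix (σ : Substitution A) (k : ℕ) (b : A) (v : List A) (m : ℕ) : List A :=
  b :: (List.range m).flatMap fun j => σ.mapWord^[k * j] v

/-- For a set `B` of letters which is closed under `σ` (that is, `σ(c) ∈ B⁺` for `c ∈ B`), this is
the language `L(σ|_B)` of the restricted substitution `σ|_B : B → B⁺`: the words that are factors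
of some `σⁿ(c)`, `n ≥ 1`, `c ∈ B`. For `B = univ` it is `L(σ)`. -/
def language (σ : Substitution A) (B : Set A) : Set (List A) :=
  {w | ∃ n : ℕ, 1 ≤ n ∧ ∃ c ∈ B, w <:+: σ.powWord n c}

/-- For a set `B` of letters which is closed under `σ`, this is the substitution dynamical system
`X_{σ|_B}`: the bi-infinite sequences `x` with `x_{[-i,i]} ∈ L(σ|_B)` for every `i ≥ 1`.
For `B = univ` it is `X_σ`. -/
def subshift (σ : Substitution A) (B : Set A) : Set (ℤ → A) :=
  {x | ∀ i : ℕ, 1 ≤ i → window x (-(i : ℤ)) (2 * i + 1) ∈ σ.language B}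

/-- `∅ = A_0 ⊊ A_1 ⊊ ⋯ ⊊ A_n = A` exhibits `σ` as a substitution of `n` primitive components
(`A_i = comp i`; the values `comp i` for `i > n` play no role). -/
structure IsOfPrimitiveComponents (σ : Substitution A) (n : ℕ) (comp : ℕ → Set A) : Prop where
  comp_zero : comp 0 = ∅
  comp_last : comp n = Set.univ
  ssubset : ∀ i < n, comp i ⊂ comp (i + 1)
  closed : ∀ i, 1 ≤ i → i ≤ n → ∀ c ∈ comp i, ∀ d ∈ σ.toWord c, d ∈ comp i
  primitive : ∃ k : ℕ, 1 ≤ k ∧ ∀ i, 1 ≤ i → i ≤ n →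
    ∀ c ∈ comp i \ comp (i - 1), ∀ d ∈ comp i, d ∈ σ.powWord k c

/-- The hypotheses of the statement: `σ` is of `n ≥ 2` primitive components, `A_1 = {a}`,
`σ(a) = a`, and there is `p₁` such that no power `a^p` with `p ≥ p₁` belongs to `L(σ_2)`, where
`σ_2` is the restriction of `σ` to `A_2`. -/
structure IsChaconType (σ : Substitution A) (n : ℕ) (comp : ℕ → Set A) (a : A) : Prop where
  components : σ.IsOfPrimitiveComponents n comp
  two_le : 2 ≤ n
  comp_one : comp 1 = {a}
  map_a : σ.toWord a = [a]
  bounded : ∃ p₁ : ℕ, ∀ p, p₁ ≤ p → List.replicate p a ∉ σ.language (comp 2)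

/-- The Chacon substitution `a ↦ a`, `b ↦ bbab`, with `a = 0` and `b = 1`. -/
def chacon : Substitution (Fin 2) where
  toWord := ![[0], [1, 1, 0, 1]]
  toWord_ne_nil := by decide

end Substitution

/-- The orbit `{Tⁿ x : n ∈ ℤ}` under the left shift `T`. -/
def shiftOrbit {A : Type*} (x : ℤ → A) : Set (ℤ → A) :=
  Set.range fun n : ℤ => SymbolicDynamics.FullShift.shift n x

/-- A set of bi-infinite sequences (with the product topology) is a minimal shift space if it is
nonempty and it is the closure of the shift orbit of each of its points. -/
def IsMinimalShift {A : Type*} [TopologicalSpace A] (X : Set (ℤ → A)) : Prop :=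
  X.Nonempty ∧ ∀ x ∈ X, closure (shiftOrbit x) = X

/-- Unique ergodicity of a (closed, shift-invariant) set `X` of bi-infinite sequences: there is
exactly one shift-invariant Borel probability measure carried by `X`. -/
def IsUniquelyErgodicShift {A : Type*} [MeasurableSpace A] (X : Set (ℤ → A)) : Prop :=
  ∃! μ : MeasureTheory.Measure (ℤ → A), MeasureTheory.IsProbabilityMeasure μ ∧
    MeasureTheory.MeasurePreserving (SymbolicDynamics.FullShift.shift (1 : ℤ)) μ μ ∧ μ Xᶜ = 0

/-! On `B = A_2` the substitution is not primitive, but every letter other than `a` behaves as in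
the primitive case, and the non-growing letter `a` is harmless because its runs in the language are
bounded. Every long enough word thus contains a growing letter, and the classical argument gives
linear recurrence (`linearly_recurrent`): for arbitrarily large `n = |σ^N(b)|`, each word of length
`n` occurs in every word of length `R * n`, with `R` independent of `n`.

Minimality follows at once. For unique ergodicity, a segment with nearly maximal Birkhoff sum recurs
in every segment `R` times longer, which forces the upper and lower rates of the sums to agree
(`exists_birkhoffSum_near`). The averages of a cylinder then converge uniformly, so its measure is
determined; Krylov–Bogoliubov gives existence.

For periodic points, follow the first, or last, letter other than `a` in successive images. The run
of `a`s beside it never shrinks and is bounded, so it is constant on a cycle of states. The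
resulting word `c a^j b` of the language grows from both ends, under a power of `σ`, into a
two-sided fixed point of that power. -/

namespace Substitution

variable {A : Type*} (σ : Substitution A)

/-! ### Iterates of a substitution on words -/

@[simp] theorem mapWord_append (u v : List A) :
    σ.mapWord (u ++ v) = σ.mapWord u ++ σ.mapWord v := by
  simp [mapWord]

@[simp] theorem iterate_append (n : ℕ) (u v : List A) :
    σ.mapWord^[n] (u ++ v) = σ.mapWord^[n] u ++ σ.mapWord^[n] v := by
  induction n generalizing u v with
  | zero => rfl
  | succ n ih => simp [ih]

@[simp] theorem iterate_nil (n : ℕ) : σ.mapWord^[n] [] = [] := by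
  induction n with
  | zero => rfl
  | succ n ih => simpa [mapWord] using ih

theorem iterate_cons (n : ℕ) (c : A) (w : List A) :
    σ.mapWord^[n] (c :: w) = σ.powWord n c ++ σ.mapWord^[n] w := by
  rw [← List.singleton_append, iterate_append]; rfl

theorem powWord_one (c : A) : σ.powWord 1 c = σ.toWord c := by
  simp [powWord, mapWord]

theorem powWord_add (m n : ℕ) (c : A) :
    σ.powWord (m + n) c = σ.mapWord^[m] (σ.powWord n c) := by
  simp [powWord, Function.iterate_add_apply]

theorem iterate_infix (n : ℕ) {u v : List A} (h : u <:+: v) :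
    σ.mapWord^[n] u <:+: σ.mapWord^[n] v := by
  obtain ⟨s, t, rfl⟩ := h
  exact ⟨σ.mapWord^[n] s, σ.mapWord^[n] t, by simp⟩

theorem iterate_prefix (n : ℕ) {u v : List A} (h : u <+: v) :
    σ.mapWord^[n] u <+: σ.mapWord^[n] v := by
  obtain ⟨t, rfl⟩ := h
  exact ⟨σ.mapWord^[n] t, by simp⟩

theorem iterate_suffix (n : ℕ) {u v : List A} (h : u <:+ v) :
    σ.mapWord^[n] u <:+ σ.mapWord^[n] v := by
  obtain ⟨t, rfl⟩ := h
  exact ⟨σ.mapWord^[n] t, by simp⟩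

theorem powWord_infix_iterate (n : ℕ) {c : A} {w : List A} (h : c ∈ w) :
    σ.powWord n c <:+: σ.mapWord^[n] w :=
  σ.iterate_infix n ((List.singleton_infix_iff c w).2 h)

theorem length_le_iterate (n : ℕ) (w : List A) : w.length ≤ (σ.mapWord^[n] w).length := by
  induction n with
  | zero => rfl
  | succ n ih =>
    rw [Function.iterate_succ_apply']
    exact ih.trans (σ.length_le_mapWord _)

theorem powWord_ne_nil (n : ℕ) (c : A) : σ.powWord n c ≠ [] := by
  have := σ.length_le_iterate n [c]
  intro h
  rw [powWord] at h
  simp [h] at this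

theorem length_iterate_le {n D : ℕ} {w : List A} (h : ∀ c ∈ w, (σ.powWord n c).length ≤ D) :
    (σ.mapWord^[n] w).length ≤ D * w.length := by
  induction w with
  | nil => simp
  | cons c w ih =>
    rw [iterate_cons, List.length_append, List.length_cons]
    have h1 := h c (by simp)
    have h2 := ih fun d hd => h d (by simp [hd])
    nlinarith

theorem exists_length_powWord_le [Finite A] (n : ℕ) :
    ∃ D, 1 ≤ D ∧ ∀ c, (σ.powWord n c).length ≤ D := by
  obtain ⟨D, hD⟩ := (Set.finite_range fun c => (σ.powWord n c).length).bddAbove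
  exact ⟨D + 1, by omega, fun c => (hD ⟨c, rfl⟩).trans (by omega)⟩

end Substitution

/-- A factor of `x ++ m ++ y` is a factor of `x ++ m` or of `m ++ y`, or has `m` as a factor. -/
theorem List.infix_or_infix_or_infix {A : Type*} {v x m y : List A} (h : v <:+: x ++ m ++ y) :
    v <:+: x ++ m ∨ v <:+: m ++ y ∨ m <:+: v := by
  obtain ⟨s, t, h⟩ := h
  rcases List.append_eq_append_iff.1 h with ⟨r, hr, ht⟩ | ⟨r, hr, ht⟩
  · exact Or.inl ⟨s, r, hr.symm⟩
  · rcases List.append_eq_append_iff.1 hr with ⟨q, hq, hv⟩ | ⟨q, hq, hv⟩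
    · rcases List.append_eq_append_iff.1 hq with ⟨p, hp, hm⟩ | ⟨p, hp, hm⟩
      · exact Or.inr (Or.inl ⟨p, t, by simp [hv, ht, hm]⟩)
      · exact Or.inr (Or.inr ⟨p, r, by simp [hv, hm]⟩)
    · exact Or.inr (Or.inl ⟨m ++ q, t, by simp [ht, hv]⟩)

/-! ### Desubstitution and linear recurrence of the language -/

namespace Substitution

variable {A : Type*} (σ : Substitution A)

/-- A factor `v` of `σⁿ(y)` is a factor of `σⁿ(z)` for a factor `z` of `y` whose interior `z'` is
such that `σⁿ(z')` is a factor of `v`. -/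
theorem exists_desubstitution (n : ℕ) {v y : List A} (h : v <:+: σ.mapWord^[n] y) :
    ∃ z z' : List A, z <:+: y ∧ z' <:+: z ∧ z.length ≤ z'.length + 2 ∧
      v <:+: σ.mapWord^[n] z ∧ σ.mapWord^[n] z' <:+: v := by
  induction hl : y.length using Nat.strong_induction_on generalizing y with
  | _ l ih =>
    by_cases hy : l ≤ 2
    · exact ⟨y, [], List.infix_rfl, List.nil_infix, by simpa [hl], h, by simp⟩
    · obtain ⟨c, m, d, rfl⟩ : ∃ c m d, y = [c] ++ m ++ [d] := by
        obtain ⟨c, y', rfl⟩ := List.exists_cons_of_ne_nil (l := y) (by rintro rfl; simp at hl; omega)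
        have h0 : y' ≠ [] := by rintro rfl; simp at hl; omega
        exact ⟨c, y'.dropLast, y'.getLast h0, by simp [List.dropLast_append_getLast]⟩
      simp only [List.length_append, List.length_singleton] at hl
      rw [iterate_append, iterate_append] at h
      -- Either an end letter of `y` can be dropped, or `v` already covers the image of the
      -- interior.
      rcases List.infix_or_infix_or_infix h with h' | h' | h'
      · rw [← iterate_append] at h'
        obtain ⟨z, z', hz, hr⟩ := ih ([c] ++ m).length (by simp; omega) h' rfl
        exact ⟨z, z', hz.trans (List.infix_append' [] _ [d]), hr⟩
      · rw [← iterate_append] at h'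
        obtain ⟨z, z', hz, hr⟩ := ih (m ++ [d]).length (by simp; omega) h' rfl
        exact ⟨z, z', hz.trans ⟨[c], [], by simp⟩, hr⟩
      · refine ⟨[c] ++ m ++ [d], m, List.infix_rfl, ⟨[c], [d], rfl⟩, by simp, ?_, h'⟩
        rwa [iterate_append, iterate_append]

/-- The substitutions obtained from `IsChaconType` by restriction to `B = A_2`: the letter `a` is
fixed, some power maps every other letter of `B` to a word in which all letters of `B` occur,
and long powers of `a` are not in the language. -/
structure IsAlmostPrimitive (σ : Substitution A) (B : Set A) (a : A) : Prop where
  mem : a ∈ B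
  map_a : σ.toWord a = [a]
  closed : ∀ c ∈ B, ∀ d ∈ σ.toWord c, d ∈ B
  primitive : ∃ k, 1 ≤ k ∧ ∀ c ∈ B, c ≠ a → ∀ d ∈ B, d ∈ σ.powWord k c
  bounded : ∃ p, ∀ w ∈ σ.language B, p ≤ w.length → ∃ c ∈ w, c ≠ a
  exists_ne : ∃ b ∈ B, b ≠ a

variable {σ}

theorem IsChaconType.isAlmostPrimitive {n : ℕ} {comp : ℕ → Set A} {a : A}
    (h : σ.IsChaconType n comp a) : σ.IsAlmostPrimitive (comp 2) a := by
  have hss := h.components.ssubset 1 h.two_le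
  rw [h.comp_one] at hss
  obtain ⟨k, hk, hprim⟩ := h.components.primitive
  obtain ⟨p, hp⟩ := h.bounded
  refine ⟨hss.1 rfl, h.map_a, h.components.closed 2 one_le_two h.two_le,
    ⟨k, hk, fun c hc hca d hd => hprim 2 one_le_two h.two_le c ?_ d hd⟩, ⟨p, ?_⟩, ?_⟩
  · simpa [h.comp_one] using ⟨hc, hca⟩
  · intro w hw hpw
    by_contra! hcon
    exact hp w.length hpw (by rwa [← List.eq_replicate_of_mem hcon])
  · obtain ⟨b, hb, hba⟩ := Set.exists_of_ssubset hss
    exact ⟨b, hb, hba⟩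

theorem language_infix {B : Set A} {u v : List A} (h : u <:+: v) (hv : v ∈ σ.language B) :
    u ∈ σ.language B := by
  obtain ⟨n, hn, c, hc, hvc⟩ := hv
  exact ⟨n, hn, c, hc, h.trans hvc⟩

theorem language_iterate {B : Set A} {w : List A} (m : ℕ) (h : w ∈ σ.language B) :
    σ.mapWord^[m] w ∈ σ.language B := by
  obtain ⟨n, hn, c, hc, hw⟩ := h
  exact ⟨m + n, by omega, c, hc, by rw [powWord_add]; exact σ.iterate_infix m hw⟩

namespace IsAlmostPrimitive

variable {B : Set A} {a : A} (h : σ.IsAlmostPrimitive B a)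
include h

theorem powWord_a (n : ℕ) : σ.powWord n a = [a] := by
  induction n with
  | zero => rfl
  | succ n ih => rw [powWord_add, powWord_one, h.map_a]; exact ih

theorem iterate_replicate_a (n j : ℕ) :
    σ.mapWord^[n] (List.replicate j a) = List.replicate j a := by
  induction j with
  | zero => simp
  | succ j ih => rw [List.replicate_succ, iterate_cons, ih, h.powWord_a]; rfl

theorem mem_of_mem_powWord {n : ℕ} {c d : A} (hc : c ∈ B) (hd : d ∈ σ.powWord n c) : d ∈ B := by
  induction n generalizing d with
  | zero => simp_all [powWord]
  | succ n ih =>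
    rw [add_comm, powWord_add] at hd
    simp only [Function.iterate_one, mapWord, List.mem_flatMap] at hd
    obtain ⟨e, he, hd⟩ := hd
    exact h.closed e (ih he) d hd

theorem mem_of_mem_language {w : List A} (hw : w ∈ σ.language B) {d : A} (hd : d ∈ w) :
    d ∈ B := by
  obtain ⟨n, -, c, hc, hw⟩ := hw
  exact h.mem_of_mem_powWord hc (hw.subset hd)

/-- The language requires an exponent at least `1`; since `c` occurs in some `σ^k(b)`, the case `n =
0` is covered too. -/
theorem powWord_mem_language (n : ℕ) {c : A} (hc : c ∈ B) : σ.powWord n c ∈ σ.language B := by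
  obtain ⟨k, hk, hprim⟩ := h.primitive
  obtain ⟨b, hb, hba⟩ := h.exists_ne
  refine ⟨n + k, by omega, b, hb, ?_⟩
  rw [powWord_add]
  exact σ.powWord_infix_iterate n (hprim b hb hba c hc)

theorem exists_infix_mapWord {w : List A} (hw : w ∈ σ.language B) :
    ∃ y ∈ σ.language B, w <:+: σ.mapWord y := by
  obtain ⟨n, hn, c, hc, hw⟩ := hw
  obtain ⟨m, rfl⟩ := Nat.exists_eq_add_of_le hn
  exact ⟨_, h.powWord_mem_language m hc, by simpa [powWord_add] using hw⟩

theorem exists_infix_iterate (n : ℕ) {w : List A} (hw : w ∈ σ.language B) :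
    ∃ y ∈ σ.language B, w <:+: σ.mapWord^[n] y := by
  induction n with
  | zero => exact ⟨w, hw, List.infix_rfl⟩
  | succ n ih =>
    obtain ⟨y, hy, hwy⟩ := ih
    obtain ⟨z, hz, hyz⟩ := h.exists_infix_mapWord hy
    exact ⟨z, hz, hwy.trans (σ.iterate_infix n hyz)⟩

/-- The image of a letter other than `a` contains a letter other than `a`. -/
theorem exists_ne_mem_toWord {c : A} (hc : c ∈ B) (hca : c ≠ a) :
    ∃ d ∈ σ.toWord c, d ≠ a := by
  -- If `σ(c)` were a power of `a`, so would be `σ^k(c)`, in which `c` occurs.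
  by_contra! hcon
  obtain ⟨k, hk, hprim⟩ := h.primitive
  obtain ⟨m, rfl⟩ := Nat.exists_eq_add_of_le' hk
  have h1 := hprim c hc hca c hc
  rw [powWord_add, powWord_one, List.eq_replicate_of_mem hcon, h.iterate_replicate_a] at h1
  exact hca (List.eq_of_mem_replicate h1)

/-- If `w` occurs in `σ^n(d)`, it occurs in `σ^(n+k)(c)` because `d` occurs in `σ^k(c)`. Larger
exponents inherit this since `σ(c)` contains a letter other than `a`. -/
theorem eventually_infix_powWord {w : List A} (hw : w ∈ σ.language B) :
    ∀ᶠ n in Filter.atTop, ∀ c ∈ B, c ≠ a → w <:+: σ.powWord n c := by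
  obtain ⟨n, -, d, hd, hw⟩ := hw
  obtain ⟨k, hk, hprim⟩ := h.primitive
  refine Filter.eventually_atTop.2 ⟨n + k, fun m hm => ?_⟩
  induction m, hm using Nat.le_induction with
  | base =>
    intro c hc hca
    rw [powWord_add]
    exact hw.trans (σ.powWord_infix_iterate n (hprim c hc hca d hd))
  | succ m hm ih =>
    intro c hc hca
    obtain ⟨e, he, hea⟩ := h.exists_ne_mem_toWord hc hca
    rw [powWord_add, powWord_one]
    exact (ih e (h.closed c hc e he) hea).trans (σ.powWord_infix_iterate m he)

/-- `|σⁿ(b)|` is unbounded. -/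
theorem exists_le_length_powWord {b : A} (hb : b ∈ B) (hba : b ≠ a) (m : ℕ) :
    ∃ n, m ≤ (σ.powWord n b).length := by
  obtain ⟨k, hk, hprim⟩ := h.primitive
  induction m with
  | zero => exact ⟨0, by simp⟩
  | succ m ih =>
    obtain ⟨n, hn⟩ := ih
    refine ⟨n + k, ?_⟩
    have h1 := hprim b hb hba b hb
    have h2 := hprim b hb hba a h.mem
    obtain ⟨s, t, hst⟩ := List.append_of_mem h1
    rw [hst] at h2
    -- Besides this `b`, the letter `a` occurs in `σ^k(b)`, so `k` more iterations gain at least one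
    -- letter.
    have h3 : s ++ t ≠ [] := by
      intro h0
      simp only [List.append_eq_nil_iff] at h0
      simp [h0.1, h0.2, hba.symm] at h2
    have h4 := σ.length_le_iterate n s
    have h5 := σ.length_le_iterate n t
    have h6 := List.length_pos_iff.2 h3
    rw [powWord_add, hst, iterate_append, iterate_cons]
    simp only [List.length_append] at h6 ⊢
    omega

theorem eventually_le_length_powWord {b : A} (hb : b ∈ B) (hba : b ≠ a) (m : ℕ) :
    ∀ᶠ n in Filter.atTop, m ≤ (σ.powWord n b).length := by
  obtain ⟨n, hn⟩ := h.exists_le_length_powWord hb hba m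
  filter_upwards [h.eventually_infix_powWord (h.powWord_mem_language n hb)] with l hl
  exact hn.trans (hl b hb hba).length_le

/-- Cut `z` into blocks of length `p`: each contains a letter other than `a`, whose image has length
at least `l / D`. -/
theorem mul_le_length_iterate {p N D l : ℕ}
    (hp : ∀ w ∈ σ.language B, p ≤ w.length → ∃ c ∈ w, c ≠ a)
    (hl : ∀ c ∈ B, c ≠ a → l ≤ D * (σ.powWord N c).length) (m : ℕ) {z : List A}
    (hz : z ∈ σ.language B) (hm : m * p ≤ z.length) :
    m * l ≤ D * (σ.mapWord^[N] z).length := by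
  induction m generalizing z with
  | zero => simp
  | succ m ih =>
    have h1 := language_infix (List.take_prefix p z).isInfix hz
    have h2 := language_infix (List.drop_suffix p z).isInfix hz
    have h0 : p ≤ z.length := by nlinarith
    obtain ⟨c, hc, hca⟩ := hp _ h1 (by simp [h0])
    have h3 := hl c (h.mem_of_mem_language h1 hc) hca
    have h4 := (σ.powWord_infix_iterate N hc).length_le
    have h5 := ih h2 (by rw [List.length_drop]; rw [Nat.succ_mul] at hm; omega)
    rw [← List.take_append_drop p z, iterate_append, List.length_append, Nat.succ_mul]
    nlinarith

/-- Linear recurrence of the language, along a sequence of lengths. -/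
theorem linearly_recurrent [Finite A] : ∃ R : ℕ, ∀ n₀ : ℕ, ∃ n, n₀ ≤ n ∧
    ∀ u ∈ σ.language B, ∀ v ∈ σ.language B, v.length = n → R * n ≤ u.length → v <:+: u := by
  obtain ⟨b, hb, hba⟩ := h.exists_ne
  obtain ⟨k, hk, hprim⟩ := h.primitive
  obtain ⟨p, hp⟩ := h.bounded
  obtain ⟨D, hD1, hD⟩ := σ.exists_length_powWord_le k
  -- `σ^N(c)` is a factor of `σ^k(σ^N(d))`; the constant `D` does not depend on `N`.
  have hcomp : ∀ N, ∀ c ∈ B, ∀ d ∈ B, d ≠ a →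
      (σ.powWord N c).length ≤ D * (σ.powWord N d).length := by
    intro N c hc d hd hda
    have h1 := (σ.powWord_infix_iterate N (hprim d hd hda c hc)).length_le
    rw [← powWord_add, add_comm, powWord_add] at h1
    exact h1.trans (σ.length_iterate_le fun e _ => hD e)
  -- Desubstituting `v` will give words `z` of this bounded length. They are finitely many, so one
  -- `J`, chosen before `N`, serves them all.
  have hJ : ∀ᶠ J in Filter.atTop, ∀ z ∈ {z : List A | z.length ≤ (D + 1) * p + 2},
      z ∈ σ.language B → ∀ c ∈ B, c ≠ a → z <:+: σ.powWord J c := by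
    rw [Filter.eventually_all_finite (List.finite_length_le A _)]
    intro z _
    by_cases hz : z ∈ σ.language B
    · filter_upwards [h.eventually_infix_powWord hz] with J hJ _ using hJ
    · simp [hz]
  obtain ⟨J, hJ⟩ := hJ.exists
  obtain ⟨E, hE1, hE⟩ := σ.exists_length_powWord_le J
  -- Images under `σ^(N+J)` of letters have length at most `E * D * n`, and a word of `p + 3`
  -- letters has an interior of at least `p + 1`, which contains a letter other than `a`.
  refine ⟨(p + 3) * (E * D), fun n₀ => ?_⟩
  obtain ⟨N, hN⟩ := h.exists_le_length_powWord hb hba n₀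
  refine ⟨_, hN, fun u hu v hv hvl hul => ?_⟩
  set n := (σ.powWord N b).length with hn
  have hn1 : 1 ≤ n := List.length_pos_iff.2 (σ.powWord_ne_nil N b)
  have hv' : ∀ c ∈ B, c ≠ a → v <:+: σ.powWord (N + J) c := by
    obtain ⟨y, hy, hvy⟩ := h.exists_infix_iterate N hv
    obtain ⟨z, z', hz, hz', hzz', hvz, hzv⟩ := σ.exists_desubstitution N hvy
    have hzL := language_infix hz hy
    intro c hc hca
    rw [powWord_add]
    refine hvz.trans (σ.iterate_infix N (hJ z ?_ hzL c hc hca))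
    -- A longer `z` has an interior `z'` with `D + 1` blocks of length `p`, so `(D + 1) * n ≤ D *
    -- |σ^N(z')| ≤ D * n`, which is absurd.
    by_contra hlen
    simp only [Set.mem_ofPred_eq, not_le] at hlen
    have h1 := h.mul_le_length_iterate hp (fun c hc hca => hcomp N b hb c hc hca) (D + 1)
      (language_infix hz' hzL) (by omega)
    have h2 := hzv.length_le
    rw [← hn] at h1
    nlinarith
  obtain ⟨y, hy, huy⟩ := h.exists_infix_iterate (N + J) hu
  obtain ⟨z, z', hz, hz', hzz', huz, hzu⟩ := σ.exists_desubstitution (N + J) huy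
  have hzL := language_infix hz hy
  have hlen : (σ.mapWord^[N + J] z).length ≤ E * D * n * z.length := by
    refine σ.length_iterate_le fun c hc => ?_
    have h1 : (σ.powWord (N + J) c).length ≤ E * (σ.powWord N c).length := by
      rw [add_comm, powWord_add]
      exact σ.length_iterate_le fun e _ => hE e
    have h2 := hcomp N c (h.mem_of_mem_language hzL hc) b hb hba
    calc _ ≤ _ := h1
      _ ≤ E * (D * n) := Nat.mul_le_mul_left _ h2
      _ = _ := by ring
  have hz3 : p + 3 ≤ z.length := by
    have h1 : (E * D * n) * (p + 3) ≤ (E * D * n) * z.length := by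
      calc _ = (p + 3) * (E * D) * n := by ring
        _ ≤ _ := hul
        _ ≤ _ := huz.length_le
        _ ≤ _ := hlen
    exact Nat.le_of_mul_le_mul_left h1 (by positivity)
  obtain ⟨c, hc, hca⟩ := hp z' (language_infix hz' hzL) (by omega)
  exact (hv' c (h.mem_of_mem_language hzL (hz'.subset hc)) hca).trans
    ((σ.powWord_infix_iterate _ hc).trans hzu)

end IsAlmostPrimitive

end Substitution

/-! ### Uniform convergence of Birkhoff sums -/

section Birkhoff

open Filter Topology

variable {Ω : Type*} {X : Set Ω} {T : Ω → Ω} {f : Ω → ℝ}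

theorem birkhoffSum_mem_Icc (hf : ∀ x, f x ∈ Set.Icc (0 : ℝ) 1) (n : ℕ) (x : Ω) :
    birkhoffSum T f n x ∈ Set.Icc (0 : ℝ) n := by
  constructor
  · exact Finset.sum_nonneg fun i _ => (hf _).1
  · exact (Finset.sum_le_card_nsmul _ _ 1 fun i _ => (hf _).2).trans (by simp)

/-- If long enough orbit segments of all points of `X` contain segments along which the Birkhoff
sums of `f` are almost as large as along a given segment, then the Birkhoff averages converge
uniformly on `X`. -/
theorem exists_birkhoffSum_near (hX : X.Nonempty) (hT : Set.MapsTo T X X)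
    (hf : ∀ x, f x ∈ Set.Icc (0 : ℝ) 1)
    (hrec : ∃ R r : ℕ, ∀ n₀, ∃ n, n₀ ≤ n ∧ ∀ x ∈ X, ∀ y ∈ X, ∃ i, i + n ≤ R * n ∧
      birkhoffSum T f n x ≤ birkhoffSum T f n (T^[i] y) + r) :
    ∃ L : ℝ, ∀ ε > 0, ∀ᶠ n : ℕ in atTop, ∀ x ∈ X, |birkhoffSum T f n x - L * n| ≤ ε * n := by
  obtain ⟨R, r, hrec⟩ := hrec
  have : Nonempty X := hX.to_subtype
  have hS := fun n (x : Ω) => birkhoffSum_mem_Icc (T := T) hf n x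
  have hbdd : ∀ n, BddAbove (Set.range fun x : X => birkhoffSum T f n x) := fun n =>
    ⟨n, by rintro _ ⟨x, rfl⟩; exact (hS n x).2⟩
  have hbdd' : ∀ n, BddBelow (Set.range fun x : X => birkhoffSum T f n x) := fun n =>
    ⟨0, by rintro _ ⟨x, rfl⟩; exact (hS n x).1⟩
  set b : ℕ → ℝ := fun n => ⨆ x : X, birkhoffSum T f n x with hb
  set a : ℕ → ℝ := fun n => ⨅ x : X, birkhoffSum T f n x with ha
  have hle_b : ∀ n, ∀ x ∈ X, birkhoffSum T f n x ≤ b n := fun n x hx =>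
    le_ciSup (hbdd n) (⟨x, hx⟩ : X)
  have ha_le : ∀ n, ∀ x ∈ X, a n ≤ birkhoffSum T f n x := fun n x hx =>
    ciInf_le (hbdd' n) (⟨x, hx⟩ : X)
  have hTi : ∀ i, ∀ x ∈ X, T^[i] x ∈ X := fun i x hx => hT.iterate i hx
  have ha0 : ∀ n, 0 ≤ a n := fun n => le_ciInf fun x => (hS n x).1
  have hb0 : ∀ n, 0 ≤ b n := fun n => (ha0 n).trans (ciInf_le_ciSup (hbdd' n) (hbdd n))
  have han : ∀ n, a n ≤ n := fun n => (ciInf_le_ciSup (hbdd' n) (hbdd n)).trans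
    (ciSup_le fun x => (hS n x).2)
  have hbsub : Subadditive b := fun m n => ciSup_le fun x => by
    rw [birkhoffSum_add]
    exact add_le_add (hle_b m x x.2) (hle_b n _ (hTi m x x.2))
  have hasub : Subadditive (fun n => -a n) := fun m n => by
    have : a m + a n ≤ a (m + n) := le_ciInf fun x => by
      rw [birkhoffSum_add]
      exact add_le_add (ha_le m x x.2) (ha_le n _ (hTi m x x.2))
    simp only
    linarith
  have hbb : BddBelow (Set.range fun n => b n / n) :=
    ⟨0, by rintro _ ⟨n, rfl⟩; exact div_nonneg (hb0 n) n.cast_nonneg⟩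
  have hab : BddBelow (Set.range fun n => -a n / n) :=
    ⟨-1, by
      rintro _ ⟨n, rfl⟩
      simp only [neg_div, neg_le_neg_iff]
      exact div_le_one_of_le₀ (han n) n.cast_nonneg⟩
  have htb := hbsub.tendsto_lim hbb
  have hta := hasub.tendsto_lim hab
  set M := hbsub.lim
  set m := -hasub.lim with hm
  have hMb : ∀ n : ℕ, M * n ≤ b n := fun n => by
    rcases Nat.eq_zero_or_pos n with rfl | hn
    · simpa using hb0 0
    · exact (le_div_iff₀ (by exact_mod_cast hn)).1 (hbsub.lim_le_div hbb hn.ne')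
  have ham : ∀ n : ℕ, a n ≤ m * n := fun n => by
    rcases Nat.eq_zero_or_pos n with rfl | hn
    · simpa using han 0
    · have := (le_div_iff₀ (by exact_mod_cast hn)).1 (hasub.lim_le_div hab hn.ne')
      rw [hm]; linarith
  have hbM : ∀ ε > 0, ∀ᶠ n : ℕ in atTop, b n ≤ (M + ε) * n := fun ε hε => by
    filter_upwards [htb.eventually_lt_const (lt_add_of_pos_right M hε), eventually_gt_atTop 0]
      with n h1 h2
    exact ((div_lt_iff₀ (by exact_mod_cast h2)).1 h1).le
  have hma : ∀ ε > 0, ∀ᶠ n : ℕ in atTop, (m - ε) * n ≤ a n := fun ε hε => by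
    filter_upwards [hta.eventually_lt_const (lt_add_of_pos_right _ hε), eventually_gt_atTop 0]
      with n h1 h2
    have := ((div_lt_iff₀ (by exact_mod_cast h2)).1 h1).le
    rw [hm]; linarith
  have hm1 : m ≤ 1 := by
    have : -1 ≤ hasub.lim := by
      refine ge_of_tendsto' hta fun n => ?_
      simp only [neg_div, neg_le_neg_iff]
      exact div_le_one_of_le₀ (han n) n.cast_nonneg
    linarith
  -- Here `M` and `m` are the limits of `b n / n` and `a n / n` given by Fekete's lemma.
  have hMm : M ≤ m := by
    by_contra! hlt
    set δ := M - m with hδ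
    have hδ0 : 0 < δ := by linarith
    obtain ⟨n₁, hn₁⟩ := eventually_atTop.1 (hma (δ / (2 * (R + 1))) (by positivity))
    set ε := δ / (2 * (R + 1)) with hε
    have hε0 : 0 < ε := by positivity
    have hεR : ε * R ≤ δ / 2 := by
      rw [hε, div_mul_eq_mul_div, div_le_div_iff₀ (by positivity) two_pos]
      nlinarith
    -- Subtracting `n₁` makes the bound valid for all `n`: for `n ≤ n₁` the left side is
    -- nonpositive, as `m ≤ 1`.
    have hma' : ∀ n : ℕ, (m - ε) * n - n₁ ≤ a n := fun n => by
      rcases le_total n₁ n with h | h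
      · have := hn₁ n h
        have : (0 : ℝ) ≤ n₁ := n₁.cast_nonneg
        linarith
      · have h1 : (n : ℝ) ≤ n₁ := by exact_mod_cast h
        have h2 : (m - ε) * n ≤ 1 * n :=
          mul_le_mul_of_nonneg_right (by linarith) n.cast_nonneg
        have := ha0 n
        linarith
    obtain ⟨n₀, hn₀⟩ := exists_nat_gt (2 * (2 * n₁ + 1 + r) / δ)
    obtain ⟨n, hn, hrec⟩ := hrec n₀
    obtain ⟨⟨x, hx⟩, hxb⟩ := exists_lt_of_lt_ciSup (sub_one_lt (b n))
    -- Split the orbit segment of length `R * n` around a near copy of the almost maximal segment of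
    -- `x`; the two outer pieces obey `hma'`. Against `a (R * n) ≤ m * R * n` this bounds `n`.
    have hlow : (m - ε) * (R * n - n) - 2 * n₁ + (M * n - 1 - r) ≤ a (R * n) := by
      refine le_ciInf fun y => ?_
      obtain ⟨i, hi, hxy⟩ := hrec x hx y y.2
      obtain ⟨j, hj⟩ := Nat.exists_eq_add_of_le hi
      have hj' : (R : ℝ) * n = i + n + j := by exact_mod_cast hj
      rw [hj, birkhoffSum_add, birkhoffSum_add, hj']
      have h1 := (hma' i).trans (ha_le i y y.2)
      have h2 := (hma' j).trans (ha_le j _ (hTi (i + n) y y.2))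
      have h3 := hMb n
      simp only at hxb
      nlinarith
    have hup := ham (R * n)
    have h1 : δ * n ≤ ε * R * n + (2 * n₁ + 1 + r) := by
      push_cast at hup
      have : 0 ≤ ε * n := by positivity
      nlinarith
    have h2 : ε * R * n ≤ δ / 2 * n := mul_le_mul_of_nonneg_right hεR n.cast_nonneg
    have h3 : (n₀ : ℝ) ≤ n := by exact_mod_cast hn
    rw [div_lt_iff₀ hδ0] at hn₀
    nlinarith
  refine ⟨M, fun ε hε => ?_⟩
  filter_upwards [hbM ε hε, hma ε hε] with n h1 h2 x hx
  have h3 := hle_b n x hx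
  have h4 := ha_le n x hx
  have h5 : (M - ε) * n ≤ (m - ε) * n := mul_le_mul_of_nonneg_right (by linarith) n.cast_nonneg
  rw [abs_le]
  constructor <;> linarith

end Birkhoff

/-! ### Invariant measures -/

section InvariantMeasure

open MeasureTheory Filter Topology

variable {Ω : Type*} [MeasurableSpace Ω]

/-- If the Birkhoff averages of the indicator function of `E` converge to `L` uniformly on `X`, then
`L` is the measure of `E` for every invariant probability measure carried by `X`. -/
theorem measureReal_eq_of_birkhoffSum {X E : Set Ω} {T : Ω → Ω} (hE : MeasurableSet E) {L : ℝ}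
    (hL : ∀ ε > 0, ∀ᶠ n : ℕ in atTop, ∀ x ∈ X,
      |birkhoffSum T (E.indicator 1) n x - L * n| ≤ ε * n)
    {μ : Measure Ω} [IsProbabilityMeasure μ] (hT : MeasurePreserving T μ μ) (hX : μ Xᶜ = 0) :
    μ.real E = L := by
  have hint : ∀ i, Integrable (fun x => E.indicator (1 : Ω → ℝ) (T^[i] x)) μ := fun i =>
    (hT.iterate i).integrable_comp_of_integrable
      ((integrable_const (1 : ℝ)).indicator hE)
  have hsum : ∀ n, ∫ x, birkhoffSum T (E.indicator (1 : Ω → ℝ)) n x ∂μ = n * μ.real E := by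
    intro n
    simp only [birkhoffSum]
    rw [integral_finsetSum _ fun i _ => hint i]
    rw [Finset.sum_congr rfl (g := fun _ => μ.real E), Finset.sum_const, Finset.card_range,
      nsmul_eq_mul]
    intro i _
    have h1 := (hT.iterate i).map_eq
    conv_rhs => rw [← integral_indicator_one hE, ← h1]
    rw [integral_map (hT.iterate i).aemeasurable]
    exact ((measurable_const (a := (1 : ℝ))).indicator hE).aestronglyMeasurable
  have hae : ∀ᵐ x ∂μ, x ∈ X := by rwa [ae_iff]
  refine eq_of_forall_dist_le fun ε hε => ?_
  obtain ⟨n, hn, hn0⟩ := ((hL ε hε).and (eventually_gt_atTop 0)).exists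
  have hn0' : (0 : ℝ) < n := by exact_mod_cast hn0
  -- Integrating the uniform estimate gives `n * |μ(E) - L| ≤ ε * n`.
  have h1 : ‖∫ x, (birkhoffSum T (E.indicator (1 : Ω → ℝ)) n x - L * n) ∂μ‖ ≤
      ε * n * μ.real Set.univ :=
    norm_integral_le_of_norm_le_const (hae.mono fun x hx => hn x hx)
  have hbi : Integrable (birkhoffSum T (E.indicator (1 : Ω → ℝ)) n) μ :=
    integrable_finsetSum _ fun i _ => hint i
  rw [integral_sub hbi (integrable_const _), hsum,
    integral_const, probReal_univ, one_smul, mul_one, mul_comm (n : ℝ), ← sub_mul, norm_mul,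
    Real.norm_eq_abs, Real.norm_eq_abs, Nat.abs_cast] at h1
  exact le_of_mul_le_mul_right h1 hn0'

/-- **Krylov–Bogoliubov**: a continuous self-map of a compact space has an invariant probability
measure carried by a given nonempty closed invariant set. -/
theorem exists_invariant_probabilityMeasure [TopologicalSpace Ω] [CompactSpace Ω] [T2Space Ω]
    [HasOuterApproxClosed Ω] [BorelSpace Ω] {T : Ω → Ω} (hT : Continuous T) {X : Set Ω}
    (hX : IsClosed X) (hne : X.Nonempty) (hTX : Set.MapsTo T X X) :
    ∃ μ : Measure Ω, IsProbabilityMeasure μ ∧ MeasurePreserving T μ μ ∧ μ Xᶜ = 0 := by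
  obtain ⟨x, hx⟩ := hne
  have hTi : ∀ i, T^[i] x ∈ X := fun i => hTX.iterate i hx
  let ν : ℕ → Measure Ω := fun n =>
    ((n + 1 : ℕ) : ENNReal)⁻¹ • ∑ i ∈ Finset.range (n + 1), Measure.dirac (T^[i] x)
  have hν : ∀ n, IsProbabilityMeasure (ν n) := fun n => ⟨by
    simp only [ν, Measure.smul_apply, Measure.finsetSum_apply, measure_univ, Finset.sum_const,
      Finset.card_range, smul_eq_mul, nsmul_eq_mul, mul_one]
    exact ENNReal.inv_mul_cancel (by simp) (ENNReal.natCast_ne_top _)⟩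
  have hνint : ∀ n (g : BoundedContinuousFunction Ω ℝ),
      ∫ y, g y ∂ν n = ((n + 1 : ℕ) : ℝ)⁻¹ * birkhoffSum T g (n + 1) x := by
    intro n g
    simp only [ν]
    rw [integral_smul_measure, integral_finsetSum_measure fun i _ => g.integrable _]
    rw [ENNReal.toReal_inv, ENNReal.toReal_natCast]
    simp [birkhoffSum, integral_dirac' _ _ g.continuous.stronglyMeasurable]
  have hνX : ∀ n, ν n Xᶜ = 0 := fun n => by
    simp [ν, Measure.finsetSum_apply, Measure.dirac_apply' _ hX.measurableSet.compl, hTi]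
  let P : ℕ → ProbabilityMeasure Ω := fun n => ⟨ν n, hν n⟩
  -- With a limit along an ultrafilter, compactness of the space of probability measures suffices.
  let U := hyperfilter ℕ
  obtain ⟨μ, -, hμ⟩ := isCompact_univ.ultrafilter_le_nhds (U.map P) (by simp)
  have hlim : Tendsto P (U : Filter ℕ) (𝓝 μ) := hμ
  refine ⟨μ, inferInstance, ⟨hT.measurable, ?_⟩, ?_⟩
  · have : IsProbabilityMeasure (Measure.map T (μ : Measure Ω)) :=
      Measure.isProbabilityMeasure_map hT.measurable.aemeasurable
    refine ext_of_forall_integral_eq_of_IsFiniteMeasure fun g => ?_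
    rw [integral_map hT.measurable.aemeasurable
      g.continuous.stronglyMeasurable.aestronglyMeasurable]
    have h1 := ProbabilityMeasure.tendsto_iff_forall_integral_tendsto.1 hlim
    have h2 := h1 (g.compContinuous ⟨T, hT⟩)
    have h3 := h1 g
    -- This is the difference of the integrals of `g ∘ T` and `g` against `ν n`, after telescoping.
    have h4 : Tendsto (fun n : ℕ => ((n + 1 : ℕ) : ℝ)⁻¹ * (g (T^[n + 1] x) - g x))
        (U : Filter ℕ) (𝓝 0) := by
      refine Tendsto.mono_left ?_ (Nat.hyperfilter_le_atTop)
      refine squeeze_zero_norm (a := fun n : ℕ => ((n + 1 : ℕ) : ℝ)⁻¹ * (2 * ‖g‖)) (fun n => ?_) ?_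
      · rw [norm_mul, Real.norm_of_nonneg (by positivity)]
        refine mul_le_mul_of_nonneg_left ?_ (by positivity)
        refine (norm_sub_le _ _).trans ?_
        have := g.norm_coe_le_norm (T^[n + 1] x)
        have := g.norm_coe_le_norm x
        linarith
      · have := ((tendsto_inv_atTop_nhds_zero_nat (𝕜 := ℝ)).comp (tendsto_add_atTop_nat 1)).mul_const
          (2 * ‖g‖)
        simpa using this
    have h5 := h2.sub h3
    refine sub_eq_zero.1 (tendsto_nhds_unique h5 (h4.congr fun n => ?_))
    simp only [P, ProbabilityMeasure.coe_mk]
    rw [hνint, hνint, ← mul_sub, ← birkhoffSum_apply_sub_birkhoffSum]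
    simp [birkhoffSum, ← Function.iterate_succ_apply' T, Function.iterate_succ_apply]
  · have h1 := ProbabilityMeasure.le_liminf_measure_open_of_tendsto hlim hX.isOpen_compl
    simpa [P, hνX] using h1

end InvariantMeasure

open SymbolicDynamics.FullShift (shift)

/-! ### Windows of bi-infinite sequences -/

section Window

variable {A : Type*}

@[simp] theorem length_window (x : ℤ → A) (m : ℤ) (k : ℕ) : (window x m k).length = k := by
  simp [window]

theorem getElem?_window (x : ℤ → A) (m : ℤ) {k i : ℕ} (hi : i < k) :
    (window x m k)[i]? = some (x (m + i)) := by
  simp [window, hi]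

theorem window_eq_iff {x y : ℤ → A} {m m' : ℤ} {k : ℕ} :
    window x m k = window y m' k ↔ ∀ i < k, x (m + (i : ℕ)) = y (m' + (i : ℕ)) := by
  simp only [window, List.ofFn_inj, funext_iff, Fin.forall_iff]

theorem window_add (x : ℤ → A) (m : ℤ) (k l : ℕ) :
    window x m (k + l) = window x m k ++ window x (m + k) l := by
  simp [window, List.ofFn_add, add_assoc]

theorem window_infix (x : ℤ → A) {m m' : ℤ} {k k' : ℕ} (h : m ≤ m') (h' : m' + k' ≤ m + k) :
    window x m' k' <:+: window x m k := by
  obtain ⟨i, hi⟩ := Int.eq_ofNat_of_zero_le (sub_nonneg.2 h)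
  obtain ⟨j, rfl⟩ := Nat.exists_eq_add_of_le (show i + k' ≤ k by omega)
  obtain rfl : m' = m + i := by omega
  rw [window_add, window_add]
  exact ⟨_, _, rfl⟩

theorem window_shift (x : ℤ → A) (g m : ℤ) (k : ℕ) :
    window (shift g x) m k = window x (g + m) k := by
  simp [window, add_assoc]

theorem exists_window_eq_of_infix {x y : ℤ → A} {m m' : ℤ} {k k' : ℕ}
    (h : window x m k <:+: window y m' k') :
    ∃ i : ℕ, i + k ≤ k' ∧ window y (m' + i) k = window x m k := by
  obtain ⟨s, t, h⟩ := h
  have hl := congrArg List.length h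
  simp only [List.length_append, length_window] at hl
  refine ⟨s.length, by omega, ?_⟩
  obtain rfl : k' = s.length + (k + t.length) := by omega
  rw [window_add, window_add, List.append_assoc] at h
  have h1 := List.append_inj h (by simp)
  exact (List.append_inj h1.2 (by simp)).1.symm

theorem shift_one_iterate (i : ℕ) : (shift (A := A) (1 : ℤ))^[i] = shift (i : ℤ) := by
  induction i with
  | zero => funext x; simp
  | succ i ih =>
    funext x n
    rw [Function.iterate_succ_apply, ih]
    simp only [SymbolicDynamics.FullShift.shift_apply]
    congr 1; push_cast; ring

end Window

/-! ### Minimality and unique ergodicity of the subshift -/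

namespace Substitution

variable {A : Type*} {σ : Substitution A} {B : Set A}

theorem mem_subshift_iff {x : ℤ → A} :
    x ∈ σ.subshift B ↔ ∀ m k, window x m k ∈ σ.language B := by
  refine ⟨fun h m k => ?_, fun h i _ => h _ _⟩
  refine language_infix (window_infix x ?_ ?_) (h (m.natAbs + k + 1) (by omega)) <;>
    grind

theorem shift_mem_subshift {x : ℤ → A} (hx : x ∈ σ.subshift B) (g : ℤ) :
    shift g x ∈ σ.subshift B := by
  rw [mem_subshift_iff] at hx ⊢
  intro m k
  rw [window_shift]
  exact hx _ _

theorem isClosed_subshift [TopologicalSpace A] [DiscreteTopology A] :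
    IsClosed (σ.subshift B) := by
  have : σ.subshift B = ⋂ i : ℕ, ⋂ _ : 1 ≤ i, (fun (x : ℤ → A) (j : Fin (2 * i + 1)) =>
      x (-(i : ℤ) + (j : ℤ))) ⁻¹' {f | List.ofFn f ∈ σ.language B} := by
    ext x
    simp [subshift, window]
  rw [this]
  exact isClosed_iInter fun i => isClosed_iInter fun _ =>
    (isClosed_discrete _).preimage (by fun_prop)

namespace IsAlmostPrimitive

variable {a : A} (h : σ.IsAlmostPrimitive B a)
include h

/-- Linear recurrence of the subshift, along a sequence of lengths. -/
theorem subshift_linearly_recurrent [Finite A] : ∃ R : ℕ, ∀ n₀ : ℕ, ∃ n, n₀ ≤ n ∧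
    ∀ x ∈ σ.subshift B, ∀ y ∈ σ.subshift B, ∃ i, i + n ≤ R * n ∧
      ∀ j < n, y ((i + j : ℕ) : ℤ) = x (j : ℤ) := by
  obtain ⟨R, hR⟩ := h.linearly_recurrent
  refine ⟨R, fun n₀ => ?_⟩
  obtain ⟨n, hn, hR⟩ := hR n₀
  refine ⟨n, hn, fun x hx y hy => ?_⟩
  rw [mem_subshift_iff] at hx hy
  obtain ⟨i, hi, hiw⟩ := exists_window_eq_of_infix
    (hR _ (hy 0 (R * n)) _ (hx 0 n) (length_window _ _ _) (length_window _ _ _).ge)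
  refine ⟨i, hi, fun j hj => ?_⟩
  simpa using window_eq_iff.1 hiw j hj

theorem closure_shiftOrbit [Finite A] [TopologicalSpace A] [DiscreteTopology A] {x : ℤ → A}
    (hx : x ∈ σ.subshift B) : closure (shiftOrbit x) = σ.subshift B := by
  refine Set.Subset.antisymm (closure_minimal ?_ isClosed_subshift) fun y hy => ?_
  · rintro _ ⟨g, rfl⟩
    exact shift_mem_subshift hx g
  · obtain ⟨R, hR⟩ := h.subshift_linearly_recurrent
    have hex : ∀ m : ℕ, ∃ g : ℤ, ∀ l : ℤ, l.natAbs ≤ m → shift g x l = y l := by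
      intro m
      obtain ⟨n, hn, hR⟩ := hR (2 * m + 1)
      -- The shift by `-m` moves the central word of `y` on `[-m, m]` to `[0, 2m]`, where recurrence
      -- applies.
      obtain ⟨i, -, hi⟩ := hR _ (shift_mem_subshift hy (-(m : ℤ))) x hx
      refine ⟨i + m, fun l hl => ?_⟩
      have h1 := hi (m + l).toNat (by omega)
      rw [SymbolicDynamics.FullShift.shift_apply, Nat.cast_add,
        Int.toNat_of_nonneg (by omega)] at h1
      rw [SymbolicDynamics.FullShift.shift_apply, add_assoc, h1]
      congr 1; omega
    choose g hg using hex
    refine mem_closure_of_tendsto (f := fun m => shift (g m) x) (b := Filter.atTop) ?_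
      (Filter.Eventually.of_forall fun m => ⟨g m, rfl⟩)
    refine tendsto_pi_nhds.2 fun l => tendsto_const_nhds.congr' ?_
    filter_upwards [Filter.eventually_ge_atTop l.natAbs] with m hm using (hg m l hm).symm

theorem isMinimalShift [Finite A] [TopologicalSpace A] [DiscreteTopology A]
    (hne : (σ.subshift B).Nonempty) : IsMinimalShift (σ.subshift B) :=
  ⟨hne, fun _ hx => h.closure_shiftOrbit hx⟩

/-- The Birkhoff averages of the indicator function of a cylinder converge uniformly. -/
theorem exists_birkhoffSum_near [Finite A] (hne : (σ.subshift B).Nonempty) {E : Set (ℤ → A)}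
    {r : ℕ} (hE : ∀ x y : ℤ → A, (∀ j < r, x (j : ℕ) = y (j : ℕ)) → (x ∈ E ↔ y ∈ E)) :
    ∃ L : ℝ, ∀ ε > 0, ∀ᶠ n : ℕ in Filter.atTop, ∀ x ∈ σ.subshift B,
      |birkhoffSum (shift (1 : ℤ)) (E.indicator 1) n x - L * n| ≤ ε * n := by
  have hf : ∀ x, E.indicator (1 : (ℤ → A) → ℝ) x ∈ Set.Icc (0 : ℝ) 1 := fun x => by
    by_cases hx : x ∈ E <;> simp [hx]
  refine _root_.exists_birkhoffSum_near hne (fun x hx => shift_mem_subshift hx 1) hf ?_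
  obtain ⟨R, hR⟩ := h.subshift_linearly_recurrent
  refine ⟨R, r, fun n₀ => ?_⟩
  obtain ⟨n, hn, hR⟩ := hR (n₀ + r)
  refine ⟨n, by omega, fun x hx y hy => ?_⟩
  obtain ⟨i, hi, hxy⟩ := hR x hx y hy
  refine ⟨i, hi, ?_⟩
  -- Only the last `r` terms look beyond the matching window; they contribute at most `r`.
  obtain ⟨m, rfl⟩ := Nat.exists_eq_add_of_le' (show r ≤ n by omega)
  rw [birkhoffSum_add, birkhoffSum_add]
  have h1 : birkhoffSum (shift (1 : ℤ)) (E.indicator (1 : (ℤ → A) → ℝ)) m x =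
      birkhoffSum (shift (1 : ℤ)) (E.indicator 1) m ((shift (1 : ℤ))^[i] y) := by
    refine Finset.sum_congr rfl fun l hl => ?_
    rw [← Function.iterate_add_apply, shift_one_iterate, shift_one_iterate]
    have h2 := hE (shift (l : ℤ) x) (shift ((l + i : ℕ) : ℤ) y) fun j hj => by
      have := hxy (l + j) (by have := Finset.mem_range.1 hl; omega)
      simp only [SymbolicDynamics.FullShift.shift_apply]
      rw [← Nat.cast_add, ← Nat.cast_add, ← this]
      congr 2; ring
    by_cases h3 : shift (l : ℤ) x ∈ E
    · simp only [Set.indicator_of_mem h3, Set.indicator_of_mem (h2.1 h3), Pi.one_apply]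
    · simp only [Set.indicator_of_notMem h3, Set.indicator_of_notMem (fun h4 => h3 (h2.2 h4))]
  have h2 := (birkhoffSum_mem_Icc (T := shift (1 : ℤ)) hf r ((shift (1 : ℤ))^[m] x)).2
  have h3 := (birkhoffSum_mem_Icc (T := shift (1 : ℤ)) hf r
    ((shift (1 : ℤ))^[m] ((shift (1 : ℤ))^[i] y))).1
  linarith

open MeasureTheory

theorem isUniquelyErgodicShift [Finite A] [TopologicalSpace A] [DiscreteTopology A]
    [MeasurableSpace A] [DiscreteMeasurableSpace A] (hne : (σ.subshift B).Nonempty) :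
    IsUniquelyErgodicShift (σ.subshift B) := by
  obtain ⟨μ, hμ⟩ := exists_invariant_probabilityMeasure (T := shift (A := A) (1 : ℤ))
    (SymbolicDynamics.FullShift.continuous_shift 1) (isClosed_subshift (σ := σ) (B := B)) hne
    (fun x hx => shift_mem_subshift hx 1)
  refine ⟨μ, hμ, fun ν hν => ?_⟩
  obtain ⟨hμ, hμT, hμX⟩ := hμ
  obtain ⟨hν, hνT, hνX⟩ := hν
  refine ext_of_generate_finite _ generateFrom_measurableCylinders.symm
    isPiSystem_measurableCylinders (fun E hE => ?_) (by simp)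
  obtain ⟨s, S, hS, rfl⟩ := (mem_measurableCylinders _).1 hE
  have hEm : MeasurableSet (cylinder (α := fun _ : ℤ => A) s S) := hS.cylinder _
  obtain ⟨r, hr⟩ : ∃ r : ℕ, ∀ i ∈ s, i.natAbs < r := by
    refine ⟨s.sup Int.natAbs + 1, fun i hi => ?_⟩
    have := Finset.le_sup (f := Int.natAbs) hi
    omega
  -- Shifting by `r` moves the coordinates of the cylinder into `[0, 2r)` and preserves its measure.
  -- The limit `L` does not depend on the measure.
  obtain ⟨L, hL⟩ := h.exists_birkhoffSum_near hne
    (E := (shift (1 : ℤ))^[r] ⁻¹' cylinder s S) (r := 2 * r) (fun x y hxy => by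
      rw [shift_one_iterate, Set.mem_preimage, Set.mem_preimage, mem_cylinder, mem_cylinder]
      suffices hs : s.restrict (shift (r : ℤ) x) = s.restrict (shift (r : ℤ) y) by rw [hs]
      funext i
      have hi := hr i i.2
      simp only [Finset.restrict, SymbolicDynamics.FullShift.shift_apply]
      have := hxy (r + i.1).toNat (by omega)
      rwa [Int.toNat_of_nonneg (by omega)] at this)
  have key : ∀ m : Measure (ℤ → A), IsProbabilityMeasure m →
      MeasurePreserving (shift (1 : ℤ)) m m → m (σ.subshift B)ᶜ = 0 →
      m (cylinder s S) = ENNReal.ofReal L := by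
    intro m hm hmT hmX
    rw [← (hmT.iterate r).measure_preimage hEm.nullMeasurableSet,
      ← measureReal_eq_of_birkhoffSum ((hmT.iterate r).measurable hEm) hL hmT hmX,
      ofReal_measureReal]
  rw [key μ hμ hμT hμX, key ν hν hνT hνX]

end IsAlmostPrimitive

end Substitution

/-! ### Sequences read off from words -/

section Reading

variable {A : Type*}

theorem window_right_eq_iff {y : ℤ → A} {l : List A} :
    window y 0 l.length = l ↔ ∀ i (hi : i < l.length), y (i : ℤ) = l[i] := by
  constructor
  · intro h i hi
    have h1 := getElem?_window y 0 hi
    rw [h, List.getElem?_eq_getElem hi, zero_add] at h1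
    exact (Option.some.inj h1).symm
  · intro h
    refine List.ext_getElem (by simp) fun i h1 h2 => ?_
    simpa [window] using h i h2

theorem window_left_eq_iff {y : ℤ → A} {l : List A} :
    window y (-(l.length : ℤ)) l.length = l ↔
      ∀ i (hi : i < l.reverse.length), y (Int.negSucc i) = l.reverse[i] := by
  constructor
  · intro h i hi
    rw [List.length_reverse] at hi
    have h1 := getElem?_window y (-(l.length : ℤ)) (show l.length - 1 - i < l.length by omega)
    rw [h, List.getElem?_eq_getElem (by omega)] at h1
    rw [List.getElem_reverse, Option.some.inj h1]
    congr 1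
    omega
  · intro h
    refine List.ext_getElem (by simp) fun i h1 h2 => ?_
    have := h (l.length - 1 - i) (by simp; omega)
    rw [List.getElem_reverse] at this
    have h3 : l.length - 1 - (l.length - 1 - i) = i := by omega
    simp only [h3] at this
    rw [← this]
    simp only [window, List.getElem_ofFn]
    congr 1
    omega

theorem exists_limit_of_prefix {V : ℕ → List A} (hV : ∀ m, V m <+: V (m + 1))
    (hlen : ∀ n, ∃ m, n ≤ (V m).length) :
    ∃ f : ℕ → A, ∀ m i (hi : i < (V m).length), f i = (V m)[i] := by
  have hmono : ∀ m m', m ≤ m' → V m <+: V m' := fun m m' h => by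
    induction m', h using Nat.le_induction with
    | base => exact List.prefix_rfl
    | succ m' _ ih => exact ih.trans (hV m')
  choose g hg using fun n => hlen (n + 1)
  refine ⟨fun n => (V (g n))[n]'(hg n), fun m i hi => ?_⟩
  rcases le_total m (g i) with h | h
  · exact ((hmono _ _ h).getElem hi).symm
  · exact (hmono _ _ h).getElem (hg i)

/-- The bi-infinite sequence which is the limit of the words `U m . V m`. -/
theorem exists_limit_of_suffix_of_prefix {U V : ℕ → List A} (hU : ∀ m, U m <:+ U (m + 1))
    (hUlen : ∀ n, ∃ m, n ≤ (U m).length) (hV : ∀ m, V m <+: V (m + 1))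
    (hVlen : ∀ n, ∃ m, n ≤ (V m).length) :
    ∃ x : ℤ → A, (∀ m, window x (-((U m).length : ℤ)) (U m).length = U m) ∧
      ∀ m, window x 0 (V m).length = V m := by
  obtain ⟨f, hf⟩ := exists_limit_of_prefix hV hVlen
  obtain ⟨g, hg⟩ := exists_limit_of_prefix (V := fun m => (U m).reverse)
    (fun m => List.reverse_prefix.2 (hU m)) (by simpa using hUlen)
  refine ⟨fun | Int.ofNat i => f i | Int.negSucc i => g i, fun m => ?_, fun m => ?_⟩
  · exact window_left_eq_iff.2 (hg m)
  · exact window_right_eq_iff.2 (hf m)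

theorem eq_of_windows {x y : ℤ → A} {U V : ℕ → List A}
    (hUlen : ∀ n, ∃ m, n ≤ (U m).length) (hVlen : ∀ n, ∃ m, n ≤ (V m).length)
    (hxU : ∀ m, window x (-((U m).length : ℤ)) (U m).length = U m)
    (hyU : ∀ m, window y (-((U m).length : ℤ)) (U m).length = U m)
    (hxV : ∀ m, window x 0 (V m).length = V m) (hyV : ∀ m, window y 0 (V m).length = V m) :
    x = y := by
  funext i
  cases i with
  | ofNat i =>
    obtain ⟨m, hm⟩ := hVlen (i + 1)
    exact (window_right_eq_iff.1 (hxV m) i hm).trans (window_right_eq_iff.1 (hyV m) i hm).symm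
  | negSucc i =>
    obtain ⟨m, hm⟩ := hUlen (i + 1)
    have hm' : i < (U m).reverse.length := by simpa using hm
    exact (window_left_eq_iff.1 (hxU m) i hm').trans (window_left_eq_iff.1 (hyU m) i hm').symm

end Reading

/-- Iterate a choice of successors; by pigeonhole the orbit repeats, and dropping its first `m`
terms makes it start on the cycle. -/
theorem exists_periodic_chain {α : Type*} {S : Set α} (hS : S.Finite) (hne : S.Nonempty)
    {r : α → α → Prop} (hr : ∀ s ∈ S, ∃ t ∈ S, r s t) :
    ∃ s : ℕ → α, (∀ i, s i ∈ S) ∧ (∀ i, r (s i) (s (i + 1))) ∧ ∃ q, 1 ≤ q ∧ s q = s 0 := by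
  have := hS.to_subtype
  choose f hfS hf using hr
  let F : S → S := fun s => ⟨f s s.2, hfS s s.2⟩
  obtain ⟨s₀, hs₀⟩ := hne
  obtain ⟨m, n, hmn, h⟩ :=
    Finite.exists_ne_map_eq_of_infinite fun n => F^[n] (⟨s₀, hs₀⟩ : S)
  wlog hlt : m < n generalizing m n
  · exact this n m hmn.symm h.symm (by omega)
  obtain ⟨q, rfl⟩ := Nat.exists_eq_add_of_lt hlt
  refine ⟨fun i => (F^[i + m] (⟨s₀, hs₀⟩ : S) : S), fun i => Subtype.prop _, fun i => ?_,
    q + 1, by omega, ?_⟩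
  · beta_reduce
    rw [add_right_comm, Function.iterate_succ_apply']
    exact hf _ _
  · beta_reduce at h ⊢
    rw [zero_add, h, show q + 1 + m = m + q + 1 by omega]

theorem List.exists_eq_replicate_append {A : Type*} {a : A} {w : List A} (h : ∃ c ∈ w, c ≠ a) :
    ∃ d c t, w = List.replicate d a ++ c :: t ∧ c ≠ a := by
  induction w with
  | nil => simp at h
  | cons x w ih =>
    by_cases hx : x = a
    · obtain ⟨d, c, t, rfl, hc⟩ := ih (by simpa [hx] using h)
      exact ⟨d + 1, c, t, by simp [List.replicate_succ, hx], hc⟩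
    · exact ⟨0, x, w, rfl, hx⟩

theorem List.exists_eq_append_replicate {A : Type*} {a : A} {w : List A} (h : ∃ c ∈ w, c ≠ a) :
    ∃ t c d, w = t ++ c :: List.replicate d a ∧ c ≠ a := by
  obtain ⟨d, c, t, hw, hc⟩ := List.exists_eq_replicate_append (w := w.reverse) (by simpa using h)
  refine ⟨t.reverse, c, d, ?_, hc⟩
  simpa using congrArg List.reverse hw

/-! ### Construction of periodic points -/

namespace Substitution

variable {A : Type*} (σ : Substitution A)

theorem mapWord_prefix {u v : List A} (h : u <+: v) : σ.mapWord u <+: σ.mapWord v :=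
  σ.iterate_prefix 1 h

theorem mapWord_suffix {u v : List A} (h : u <:+ v) : σ.mapWord u <:+ σ.mapWord v :=
  σ.iterate_suffix 1 h

/-- Coordinate `i` of `mapSeq` is read from the image of `i + 1` letters; of that image and `σ(l)`,
one is a prefix of the other. -/
theorem window_mapSeq_right {x : ℤ → A} {l : List A} (h : window x 0 l.length = l) :
    window (σ.mapSeq x) 0 (σ.mapWord l).length = σ.mapWord l := by
  refine window_right_eq_iff.2 fun i hi => ?_
  have h1 : i < (σ.mapWord (window x 0 (i + 1))).length :=
    lt_of_lt_of_le (by simp) (σ.length_le_mapWord _)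
  change (σ.mapWord (window x 0 (i + 1)))[i] = _
  rcases le_total l.length (i + 1) with h2 | h2
  · refine (List.IsPrefix.getElem (σ.mapWord_prefix ?_) hi).symm
    obtain ⟨d, hd⟩ := Nat.exists_eq_add_of_le h2
    rw [hd, window_add, h]
    exact List.prefix_append _ _
  · refine List.IsPrefix.getElem (σ.mapWord_prefix ?_) h1
    obtain ⟨d, hd⟩ := Nat.exists_eq_add_of_le h2
    rw [← h, hd, window_add x 0 (i + 1)]
    exact List.prefix_append _ _

theorem window_mapSeq_left {x : ℤ → A} {l : List A}
    (h : window x (-(l.length : ℤ)) l.length = l) :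
    window (σ.mapSeq x) (-((σ.mapWord l).length : ℤ)) (σ.mapWord l).length = σ.mapWord l := by
  refine window_left_eq_iff.2 fun i hi => ?_
  have h1 : i < (σ.mapWord (window x (-((i : ℤ) + 1)) (i + 1))).reverse.length := by
    rw [List.length_reverse]
    exact lt_of_lt_of_le (by simp) (σ.length_le_mapWord _)
  change (σ.mapWord (window x (-((i : ℤ) + 1)) (i + 1))).reverse[i] = _
  rcases le_total l.length (i + 1) with h2 | h2
  · refine (List.IsPrefix.getElem (List.reverse_prefix.2 (σ.mapWord_suffix ?_)) hi).symm
    obtain ⟨d, hd⟩ := Nat.exists_eq_add_of_le' h2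
    have h3 : -((i : ℤ) + 1) + d = -(l.length : ℤ) := by omega
    rw [hd, window_add, h3, h]
    exact List.suffix_append _ _
  · refine List.IsPrefix.getElem (List.reverse_prefix.2 (σ.mapWord_suffix ?_)) h1
    obtain ⟨d, hd⟩ := Nat.exists_eq_add_of_le' h2
    have h3 : -(l.length : ℤ) + d = -((i : ℤ) + 1) := by omega
    rw [← h, ← h3]
    conv_rhs => rw [hd, window_add, ← hd]
    exact List.suffix_append _ _

theorem window_iterate_mapSeq_right (n : ℕ) {x : ℤ → A} {l : List A}
    (h : window x 0 l.length = l) :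
    window (σ.mapSeq^[n] x) 0 (σ.mapWord^[n] l).length = σ.mapWord^[n] l := by
  induction n with
  | zero => exact h
  | succ n ih =>
    rw [Function.iterate_succ_apply', Function.iterate_succ_apply']
    exact σ.window_mapSeq_right ih

theorem window_iterate_mapSeq_left (n : ℕ) {x : ℤ → A} {l : List A}
    (h : window x (-(l.length : ℤ)) l.length = l) :
    window (σ.mapSeq^[n] x) (-((σ.mapWord^[n] l).length : ℤ)) (σ.mapWord^[n] l).length =
      σ.mapWord^[n] l := by
  induction n with
  | zero => exact h
  | succ n ih =>
    rw [Function.iterate_succ_apply', Function.iterate_succ_apply']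
    exact σ.window_mapSeq_left ih

variable {σ}

theorem rightPrefix_eq_powWord {k : ℕ} {b : A} {v : List A} (hv : σ.powWord k b = b :: v) (m : ℕ) :
    σ.rightPrefix k b v m = σ.powWord (k * m) b := by
  induction m with
  | zero => rfl
  | succ m ih =>
    rw [Nat.mul_succ, powWord_add, hv, iterate_cons, ← ih]
    simp [rightPrefix, List.range_succ]

namespace IsAlmostPrimitive

variable {B : Set A} {a : A} (h : σ.IsAlmostPrimitive B a)
include h

theorem finite_setOf_replicate [Finite A] {r : A → ℕ → Prop}
    (hr : ∀ c j, r c j → List.replicate j a ∈ σ.language B) : {s : A × ℕ | r s.1 s.2}.Finite := by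
  obtain ⟨p, hp⟩ := h.bounded
  refine (Set.finite_univ.prod (Set.finite_Iio p)).subset fun s hs => ⟨trivial, ?_⟩
  by_contra hcon
  obtain ⟨c, hc, hca⟩ := hp _ (hr _ _ hs) (by simpa using hcon)
  exact hca (List.eq_of_mem_replicate hc)

/-- Some letter other than `a` is the first letter of its image under a power of `σ`. -/
theorem exists_powWord_eq_cons [Finite A] :
    ∃ k, 1 ≤ k ∧ ∃ b ∈ B, b ≠ a ∧ ∃ v, σ.powWord k b = b :: v := by
  -- If `σ(b) = a^d c t`, then `σ(a^j b)` begins with `a^(j+d) c`: the state `(b, j)` leads to `(c,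
  -- j + d)`.
  let P : A → ℕ → Prop := fun b j => b ∈ B ∧ b ≠ a ∧ List.replicate j a ++ [b] ∈ σ.language B
  have hfin : {s : A × ℕ | P s.1 s.2}.Finite := h.finite_setOf_replicate fun c j hc =>
    language_infix (List.prefix_append _ _).isInfix hc.2.2
  have hne : {s : A × ℕ | P s.1 s.2}.Nonempty := by
    obtain ⟨b, hb, hba⟩ := h.exists_ne
    exact ⟨(b, 0), hb, hba, h.powWord_mem_language 0 hb⟩
  obtain ⟨s, hs, hr, q, hq, hsq⟩ := exists_periodic_chain hfin hne
    (r := fun s t => ∃ d, t.2 = s.2 + d ∧ List.replicate d a ++ [t.1] <+: σ.toWord s.1) (by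
      rintro ⟨b, j⟩ ⟨hb, hba, hL⟩
      obtain ⟨d, c, t, hw, hca⟩ := List.exists_eq_replicate_append (h.exists_ne_mem_toWord hb hba)
      refine ⟨(c, j + d), ⟨h.closed b hb c (by simp [hw]), hca, ?_⟩, d, rfl, t, by simp [hw]⟩
      refine language_infix ?_ (language_iterate 1 hL)
      rw [iterate_append, h.iterate_replicate_a]
      refine ⟨[], t, ?_⟩
      change _ = _ ++ σ.powWord 1 b
      simp [powWord_one, hw, ← List.replicate_append_replicate])
  have key : ∀ i, ∃ d, (s i).2 = (s 0).2 + d ∧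
      List.replicate d a ++ [(s i).1] <+: σ.powWord i (s 0).1 := by
    intro i
    induction i with
    | zero => exact ⟨0, rfl, List.prefix_rfl⟩
    | succ i ih =>
      obtain ⟨d, hd, hp⟩ := ih
      obtain ⟨d', hd', hp'⟩ := hr i
      refine ⟨d + d', by omega, ?_⟩
      rw [show σ.powWord (i + 1) (s 0).1 = σ.mapWord^[1] (σ.powWord i (s 0).1) by
        rw [← powWord_add, add_comm]]
      refine List.IsPrefix.trans ?_ (σ.iterate_prefix 1 hp)
      rw [iterate_append, h.iterate_replicate_a, List.replicate_add, List.append_assoc,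
        List.prefix_append_right_inj]
      change _ <+: σ.powWord 1 _
      rwa [powWord_one]
  obtain ⟨d, hd, v, hv⟩ := key q
  rw [hsq] at hd hv
  -- The exponent never decreases, so returning to the same state means no `a` was added in front.
  obtain rfl : d = 0 := by omega
  exact ⟨q, hq, (s 0).1, (hs 0).1, (hs 0).2.1, v, by simpa using hv.symm⟩

/-- Every letter `b` is preceded in some word of the language by a letter other than `a`. -/
theorem exists_cons_replicate_mem_language {b : A} (hb : b ∈ B) :
    ∃ c ∈ B, c ≠ a ∧ ∃ j, c :: List.replicate j a ++ [b] ∈ σ.language B := by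
  obtain ⟨b₀, hb₀, hb₀a⟩ := h.exists_ne
  obtain ⟨k, hk, hprim⟩ := h.primitive
  obtain ⟨p, hp⟩ := h.bounded
  -- Two blocks of length `p` give two letters other than `a`: the image of the first supplies a
  -- letter other than `a` to the left of a `b` in the image of the second.
  obtain ⟨N, hN⟩ := h.exists_le_length_powWord hb₀ hb₀a (p + p)
  have hwL := h.powWord_mem_language N hb₀
  set w := σ.powWord N b₀
  have h1 := language_infix (List.take_prefix p w).isInfix hwL
  have h2 := language_infix (List.drop_suffix p w).isInfix hwL
  obtain ⟨c₁, hc₁, hc₁a⟩ := hp _ h1 (by simp; omega)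
  obtain ⟨c₂, hc₂, hc₂a⟩ := hp _ h2 (by simp; omega)
  have h3 := (σ.powWord_infix_iterate k hc₁).subset
    (hprim c₁ (h.mem_of_mem_language h1 hc₁) hc₁a b₀ hb₀)
  have h4 := (σ.powWord_infix_iterate k hc₂).subset
    (hprim c₂ (h.mem_of_mem_language h2 hc₂) hc₂a b hb)
  obtain ⟨s, t, hst⟩ := List.append_of_mem h4
  obtain ⟨u, c, j, hu, hca⟩ := List.exists_eq_append_replicate (a := a)
    (w := σ.mapWord^[k] (w.take p) ++ s) ⟨b₀, by simp [h3], hb₀a⟩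
  have h5 : c :: List.replicate j a ++ [b] ∈ σ.language B := by
    refine language_infix ⟨u, t, ?_⟩ (language_iterate k hwL)
    rw [← List.take_append_drop p w, iterate_append, hst,
      show b :: t = [b] ++ t from rfl, ← List.append_assoc, ← List.append_assoc, hu]
    simp
  exact ⟨c, h.mem_of_mem_language h5 (by simp), hca, j, h5⟩

/-- If `σᵏ(b) = b v`, then `b` is preceded in the language by a word `c aʲ` such that `c ≠ a` is the
last letter of its image under a power of `σᵏ`. -/
theorem exists_powWord_eq_append_singleton [Finite A] {k : ℕ} {b : A} (hb : b ∈ B) {v : List A}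
    (hv : σ.powWord k b = b :: v) :
    ∃ q, 1 ≤ q ∧ ∃ c ∈ B, c ≠ a ∧ (∃ u, σ.powWord (k * q) c = u ++ [c]) ∧
      ∃ j, c :: List.replicate j a ++ [b] ∈ σ.language B := by
  -- Under `σ^k`, `c a^j b` becomes `σ^k(c) a^j b v`; the next state keeps the last letter other
  -- than `a` of `σ^k(c)`, and the run before `b` can only grow.
  let P : A → ℕ → Prop := fun c j =>
    c ∈ B ∧ c ≠ a ∧ c :: List.replicate j a ++ [b] ∈ σ.language B
  have hfin : {s : A × ℕ | P s.1 s.2}.Finite := h.finite_setOf_replicate fun c j hc =>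
    language_infix ⟨[c], [b], rfl⟩ hc.2.2
  have hne : {s : A × ℕ | P s.1 s.2}.Nonempty := by
    obtain ⟨c, hc, hca, j, hj⟩ := h.exists_cons_replicate_mem_language hb
    exact ⟨(c, j), hc, hca, hj⟩
  have hexists : ∀ k, ∀ c ∈ B, c ≠ a → ∃ d ∈ σ.powWord k c, d ≠ a := by
    intro k c hc hca
    induction k with
    | zero => exact ⟨c, by simp [powWord], hca⟩
    | succ k ih =>
      obtain ⟨d, hd, hda⟩ := ih
      obtain ⟨e, he, hea⟩ := h.exists_ne_mem_toWord (h.mem_of_mem_powWord hc hd) hda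
      refine ⟨e, ?_, hea⟩
      rw [add_comm, powWord_add]
      exact List.mem_flatMap.2 ⟨d, hd, he⟩
  obtain ⟨s, hs, hr, q, hq, hsq⟩ := exists_periodic_chain hfin hne
    (r := fun s t => ∃ d, t.2 = d + s.2 ∧ t.1 :: List.replicate d a <:+ σ.powWord k s.1) (by
      rintro ⟨c, j⟩ ⟨hc, hca, hL⟩
      obtain ⟨t, e, d, hw, hea⟩ := List.exists_eq_append_replicate (hexists k c hc hca)
      refine ⟨(e, d + j), ⟨h.mem_of_mem_powWord hc (n := k) (by simp [hw]), hea, ?_⟩,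
        d, rfl, t, by simp [hw]⟩
      refine language_infix ?_ (language_iterate k hL)
      rw [iterate_append, iterate_cons, h.iterate_replicate_a]
      refine ⟨t, v, ?_⟩
      change _ = _ ++ σ.powWord k b
      simp [hw, hv, ← List.replicate_append_replicate])
  have key : ∀ i, ∃ d, (s i).2 = d + (s 0).2 ∧
      (s i).1 :: List.replicate d a <:+ σ.powWord (k * i) (s 0).1 := by
    intro i
    induction i with
    | zero => exact ⟨0, by simp, List.suffix_rfl⟩
    | succ i ih =>
      obtain ⟨d, hd, hp⟩ := ih
      obtain ⟨d', hd', t, hp'⟩ := hr i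
      refine ⟨d' + d, by omega, ?_⟩
      rw [Nat.mul_succ, add_comm (k * i), powWord_add]
      refine List.IsSuffix.trans ?_ (σ.iterate_suffix k hp)
      rw [iterate_cons, h.iterate_replicate_a, ← hp']
      exact ⟨t, by simp [← List.replicate_append_replicate]⟩
  obtain ⟨d, hd, u, hu⟩ := key q
  rw [hsq] at hd hu
  obtain rfl : d = 0 := by omega
  exact ⟨q, hq, (s 0).1, (hs 0).1, (hs 0).2.1, ⟨u, hu.symm⟩, (s 0).2, (hs 0).2.2⟩

theorem exists_le_length_powWord_mul {k : ℕ} (hk : 1 ≤ k) {b : A} (hb : b ∈ B) (hba : b ≠ a)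
    (n : ℕ) : ∃ m, n ≤ (σ.powWord (k * m) b).length :=
  ((Filter.tendsto_id.const_mul_atTop' (show 0 < k by omega)).eventually
    (h.eventually_le_length_powWord hb hba n)).exists

/-- The point is the limit of `σ^(kqm)(c) a^j . σ^(km)(b)`. As `a^j` is fixed, `σ^(kq)` sends `U m`
to `U (m + 1)` and `V m` to `V (m + q)`, hence fixes the limit. -/
theorem exists_periodic_mem_subshift [Finite A] {k : ℕ} (hk : 1 ≤ k) {b : A} (hb : b ∈ B)
    (hba : b ≠ a) {v : List A} (hv : σ.powWord k b = b :: v) :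
    ∃ x ∈ σ.subshift B, x ∈ Function.periodicPts σ.mapSeq ∧
      ∀ m, window x 0 (σ.rightPrefix k b v m).length = σ.rightPrefix k b v m := by
  obtain ⟨q, hq, c, hc, hca, ⟨u, hu⟩, j, hj⟩ := h.exists_powWord_eq_append_singleton hb hv
  have hK : 1 ≤ k * q := Nat.mul_pos hk hq
  set U : ℕ → List A := fun m => σ.powWord (k * q * m) c ++ List.replicate j a with hUdef
  set V : ℕ → List A := fun m => σ.powWord (k * m) b with hVdef
  have hU : ∀ m, U m <:+ U (m + 1) := fun m => by
    refine ⟨σ.mapWord^[k * q * m] u, ?_⟩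
    simp only [hUdef]
    rw [Nat.mul_succ, powWord_add _ (k * q * m), hu, iterate_append]
    simp [powWord]
  have hV : ∀ m, V m <+: V (m + 1) := fun m => by
    refine ⟨σ.mapWord^[k * m] v, ?_⟩
    simp only [hVdef]
    rw [Nat.mul_succ, powWord_add, hv, iterate_cons]
  have hUlen : ∀ n, ∃ m, n ≤ (U m).length := fun n => by
    obtain ⟨m, hm⟩ := h.exists_le_length_powWord_mul hK hc hca n
    exact ⟨m, by simp only [hUdef, List.length_append]; omega⟩
  have hVlen : ∀ n, ∃ m, n ≤ (V m).length := h.exists_le_length_powWord_mul hk hb hba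
  have hUmono : Monotone fun m => (U m).length :=
    monotone_nat_of_le_succ fun m => (hU m).length_le
  have hVmono : Monotone fun m => (V m).length :=
    monotone_nat_of_le_succ fun m => (hV m).length_le
  obtain ⟨x, hxU, hxV⟩ := exists_limit_of_suffix_of_prefix hU hUlen hV hVlen
  refine ⟨x, fun i _ => ?_, ⟨k * q, hK, ?_⟩, fun m => ?_⟩
  · obtain ⟨m₁, hm₁⟩ := hUlen i
    obtain ⟨m₂, hm₂⟩ := hVlen (i + 1)
    have h1 := hUmono (le_max_left m₁ m₂)
    -- Index `q * m` on the right matches the exponent `k * q * m` on the left, so both halves come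
    -- from `σ^(kqm)(c a^j b)`.
    have h2 := hVmono ((le_max_right m₁ m₂).trans (Nat.le_mul_of_pos_left (max m₁ m₂) hq))
    set m := max m₁ m₂
    beta_reduce at h1 h2
    have h3 : U m ++ V (q * m) ∈ σ.language B := by
      have := language_iterate (k * q * m) hj
      rw [iterate_append, iterate_cons, h.iterate_replicate_a] at this
      simpa only [hUdef, hVdef, ← mul_assoc, powWord] using this
    have h4 : window x (-((U m).length : ℤ)) ((U m).length + (V (q * m)).length) =
        U m ++ V (q * m) := by
      rw [window_add, hxU, neg_add_cancel, hxV]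
    rw [← h4] at h3
    exact language_infix (window_infix x (by omega) (by push_cast; omega)) h3
  · refine eq_of_windows (U := fun m => U (m + 1)) (V := fun m => V (m + q)) (fun n => ?_)
      (fun n => ?_) (fun m => ?_) (fun m => hxU _) (fun m => ?_) (fun m => hxV _)
    · obtain ⟨m, hm⟩ := hUlen n
      exact ⟨m, hm.trans (hUmono m.le_succ)⟩
    · obtain ⟨m, hm⟩ := hVlen n
      exact ⟨m, hm.trans (hVmono (Nat.le_add_right m q))⟩
    · have h1 := σ.window_iterate_mapSeq_left (k * q) (hxU m)
      have h2 : σ.mapWord^[k * q] (U m) = U (m + 1) := by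
        simp only [hUdef]
        rw [iterate_append, h.iterate_replicate_a, ← powWord_add, Nat.mul_succ, add_comm]
      rwa [h2] at h1
    · have h1 := σ.window_iterate_mapSeq_right (k * q) (hxV m)
      have h2 : σ.mapWord^[k * q] (V m) = V (m + q) := by
        simp only [hVdef]
        rw [← powWord_add, Nat.mul_add, add_comm]
      rwa [h2] at h1
  · rw [rightPrefix_eq_powWord hv]
    exact hxV m

end IsAlmostPrimitive

/-! ### The Chacon substitution -/

theorem chacon_powWord_zero (n : ℕ) : chacon.powWord n 0 = [0] := by
  induction n with
  | zero => rfl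
  | succ n ih => rw [powWord_add]; exact ih

theorem chacon_powWord_succ (n : ℕ) : chacon.powWord (n + 1) 1 =
    chacon.powWord n 1 ++ (chacon.powWord n 1 ++ ([0] ++ chacon.powWord n 1)) := by
  rw [powWord_add, powWord_one]
  change chacon.mapWord^[n] [1, 1, 0, 1] = _
  rw [iterate_cons, iterate_cons, iterate_cons, chacon_powWord_zero]
  rfl

/-- With `w = σ^n(b)`, the next word is `w w a w`; as `w` begins and ends with `b`, no factor `aa`
is created. -/
theorem chacon_powWord_isChain (n : ℕ) :
    (chacon.powWord n 1).IsChain (fun c d => ¬(c = 0 ∧ d = 0)) ∧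
      (chacon.powWord n 1).head? = some 1 ∧ (chacon.powWord n 1).getLast? = some 1 := by
  induction n with
  | zero => simp [powWord]
  | succ n ih =>
    obtain ⟨h1, h2, h3⟩ := ih
    rw [chacon_powWord_succ]
    have h4 : ([0] ++ chacon.powWord n 1).getLast? = some 1 := by
      rw [List.getLast?_append, h3]; rfl
    refine ⟨?_, by simp [h2], ?_⟩
    · rw [List.isChain_append, List.isChain_append, List.isChain_append]
      simp only [h1, h2, h3, true_and, List.isChain_singleton]
      simp [h2]
    · rw [List.getLast?_append, List.getLast?_append, h4]; rfl

theorem chacon_isChaconType : chacon.IsChaconType 2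
    (fun i => if i = 0 then ∅ else if i = 1 then {0} else Set.univ) 0 where
  components :=
    { comp_zero := by simp
      comp_last := by simp
      ssubset := by
        intro i hi
        interval_cases i
        · simp
        · simp [Set.ssubset_univ_iff, Set.ext_iff]
      closed := by
        intro i h1 h2 c hc d hd
        interval_cases i
        · simp only [one_ne_zero, if_false, if_true, Set.mem_singleton_iff] at hc ⊢
          subst hc
          simpa [chacon] using hd
        · simp
      primitive := by
        refine ⟨1, le_rfl, fun i h1 h2 c hc d hd => ?_⟩
        rw [powWord_one]
        interval_cases i
        · simp at hc hd
          simp [hc, hd, chacon]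
        · simp at hc
          obtain rfl : c = 1 := by omega
          revert d
          simp [chacon] }
  two_le := le_rfl
  comp_one := by simp
  map_a := rfl
  bounded := by
    refine ⟨2, fun p hp hL => ?_⟩
    obtain ⟨n, -, c, -, hc⟩ := hL
    have h1 : [0, 0] <:+: chacon.powWord n c :=
      (show List.replicate 2 (0 : Fin 2) <:+: List.replicate p 0 by
        obtain ⟨d, rfl⟩ := Nat.exists_eq_add_of_le hp
        rw [List.replicate_add]; exact (List.prefix_append _ _).isInfix).trans hc
    fin_cases c
    · have := h1.length_le
      simp [chacon_powWord_zero] at this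
    · have := (chacon_powWord_isChain n).1.infix h1
      simp at this

end Substitution

theorem proposition3p2 :
    (∀ (A : Type*) [Finite A] [TopologicalSpace A] [DiscreteTopology A]
        [MeasurableSpace A] [DiscreteMeasurableSpace A]
        (σ : Substitution A) (n : ℕ) (comp : ℕ → Set A) (a : A),
        σ.IsChaconType n comp a →
          (∃ ω ∈ σ.subshift (comp 2), ω ∈ Function.periodicPts σ.mapSeq ∧
            σ.subshift (comp 2) = closure (shiftOrbit ω)) ∧
          (∀ k : ℕ, 1 ≤ k → ∀ b ∈ comp 2 \ comp 1, ∀ v : List A, σ.powWord k b = b :: v →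
            ∃ ω ∈ σ.subshift (comp 2), ω ∈ Function.periodicPts σ.mapSeq ∧
              (∀ m : ℕ, window ω 0 (σ.rightPrefix k b v m).length = σ.rightPrefix k b v m) ∧
              σ.subshift (comp 2) = closure (shiftOrbit ω)) ∧
          IsMinimalShift (σ.subshift (comp 2)) ∧
          IsUniquelyErgodicShift (σ.subshift (comp 2))) ∧
    (Substitution.chacon.IsChaconType 2
        (fun i => if i = 0 then ∅ else if i = 1 then {0} else Set.univ) 0 ∧
      [0, 1] ∈ Substitution.chacon.language Set.univ ∧
      Substitution.chacon.mapWord [0, 1] = [0, 1] ++ [1, 0, 1]) := by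
  refine ⟨fun A _ _ _ _ _ σ n comp a hσ => ?_, Substitution.chacon_isChaconType,
    ⟨1, le_rfl, 1, trivial, [1, 1], [], rfl⟩, rfl⟩
  have h := hσ.isAlmostPrimitive
  obtain ⟨k, hk, b, hb, hba, v, hv⟩ := h.exists_powWord_eq_cons
  obtain ⟨ω, hω, hper, -⟩ := h.exists_periodic_mem_subshift hk hb hba hv
  refine ⟨⟨ω, hω, hper, (h.closure_shiftOrbit hω).symm⟩, fun k hk b hb v hv => ?_,
    h.isMinimalShift ⟨ω, hω⟩, h.isUniquelyErgodicShift ⟨ω, hω⟩⟩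
  obtain ⟨ω, hω, hper, hpre⟩ := h.exists_periodic_mem_subshift hk hb.1
    (by simpa [hσ.comp_one] using hb.2) hv
  exact ⟨ω, hω, hper, hpre, (h.closure_shiftOrbit hω).symm⟩
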